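/- Let $$f=\begin{pmatrix} t&0&0\\0&1&0\\0&0&t^{-1}\end{pmatrix},\qquad k=\begin{pmatrix}0&-1-t&-t^{-1}-1-t\\0&t^{-1}+1+t&t^{-2}+t^{-1}+1+t\\1&0&0\end{pmatrix}\in \mathrm{SL}_3(\mathbb{Z}[t,t^{-1}]).$$ Let $p$ be a prime and let $m,n\ge 3$ be integers. Write $\bar f,\bar k\in \mathrm{SL}_3(\mathbb{F}_p[t,t^{-1}])$ for the images of $f,k$ under reduction of coefficients modulo $p$. Then $\bar f^{\,m}$ and $\bar k^{\,n}$ generate a free group of rank $2$. In terms of the Burau representation: let $B_4=\langle\sigma_1,\sigma_2,\sigma_3\mid \sigma_1\sigma_2\sigma_1=\sigma_2\sigma_1\sigma_2,\ \sigma_2\sigma_3\sigma_2=\sigma_3\sigma_2\sigma_3,\ \sigma_1\sigma_3=\sigma_3\sigma_1\rangle$ be the braid group on four strands, let $\rho\colon B_4\to \mathrm{GL}_3(\mathbb{Z}[t,t^{-1}])$ be the reduced Burau representation, $$\sigma_1\mapsto\begin{pmatrix}-t&1&0\\0&1&0\\0&0&1\end{pmatrix},\quad \sigma_2\mapsto\begin{pmatrix}1&0&0\\t&-t&1\\0&0&1\end{pmatrix},\quad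 \sigma_3\mapsto\begin{pmatrix}1&0&0\\0&1&0\\0&t&-t\end{pmatrix},$$ and let $\rho_p\colon B_4\to \mathrm{GL}_3(\mathbb{F}_p[t,t^{-1}])$ be its reduction modulo $p$. Put $\alpha=\sigma_1\sigma_3^{-1}$ and $\beta=\sigma_2\sigma_1\sigma_3^{-1}\sigma_2^{-1}$ (after the substitution $t\mapsto -t$, the matrices $\rho(\alpha)^{-1}$ and $\rho(\beta)$ are simultaneously conjugate over $\mathbb{Q}(t)$ to $f$ and $k$). Then $\rho_p(\alpha)^m$ and $\rho_p(\beta)^n$ also generate a free group of rank $2$. -/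

import Mathlib

open scoped LaurentPolynomial

noncomputable section

/-- The matrix `f = diag(t, 1, t⁻¹)` in `SL₃(ℤ[t, t⁻¹])`. -/
def burauF : Matrix.SpecialLinearGroup (Fin 3) ℤ[T;T⁻¹] :=
  ⟨!![LaurentPolynomial.T 1, 0, 0;
      0, 1, 0;
      0, 0, LaurentPolynomial.T (-1)], by
    have h : (LaurentPolynomial.T 1 : ℤ[T;T⁻¹]) * LaurentPolynomial.T (-1) = 1 := by
      rw [← LaurentPolynomial.T_add]; simp
    rw [Matrix.det_fin_three]
    simp [h]⟩

/-- The matrix `k` in `SL₃(ℤ[t, t⁻¹])`. -/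
def burauK : Matrix.SpecialLinearGroup (Fin 3) ℤ[T;T⁻¹] :=
  ⟨!![0, -1 - LaurentPolynomial.T 1,
        -LaurentPolynomial.T (-1) - 1 - LaurentPolynomial.T 1;
      0, LaurentPolynomial.T (-1) + 1 + LaurentPolynomial.T 1,
        LaurentPolynomial.T (-2) + LaurentPolynomial.T (-1) + 1 + LaurentPolynomial.T 1;
      1, 0, 0], by
    have h : (LaurentPolynomial.T 1 : ℤ[T;T⁻¹]) * LaurentPolynomial.T (-1) = 1 := by
      rw [← LaurentPolynomial.T_add]; simp
    have h2 : (LaurentPolynomial.T (-2) : ℤ[T;T⁻¹]) =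
        LaurentPolynomial.T (-1) * LaurentPolynomial.T (-1) := by
      rw [← LaurentPolynomial.T_add]; norm_num
    rw [Matrix.det_fin_three]
    simp [h2]
    linear_combination (1 - LaurentPolynomial.T (-1)) * h⟩

/-- Reduction of coefficients `ℤ[t, t⁻¹] → 𝔽_p[t, t⁻¹]`. -/
def laurentMod (p : ℕ) : ℤ[T;T⁻¹] →+* (ZMod p)[T;T⁻¹] :=
  AddMonoidAlgebra.mapRingHom ℤ (Int.castRingHom (ZMod p))

/-- The defining relators of the braid group on four strands with generators
`σ₁, σ₂, σ₃` (indexed by `0, 1, 2`):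
`σ₁σ₂σ₁ = σ₂σ₁σ₂`, `σ₂σ₃σ₂ = σ₃σ₂σ₃`, `σ₁σ₃ = σ₃σ₁`. -/
def braidRels4 : Set (FreeGroup (Fin 3)) :=
  {FreeGroup.of 0 * FreeGroup.of 1 * FreeGroup.of 0 *
      (FreeGroup.of 1 * FreeGroup.of 0 * FreeGroup.of 1)⁻¹,
    FreeGroup.of 1 * FreeGroup.of 2 * FreeGroup.of 1 *
      (FreeGroup.of 2 * FreeGroup.of 1 * FreeGroup.of 2)⁻¹,
    FreeGroup.of 0 * FreeGroup.of 2 * (FreeGroup.of 2 * FreeGroup.of 0)⁻¹}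

/-- The braid group `B₄` on four strands. -/
abbrev Braid4 : Type := PresentedGroup braidRels4

/-- The standard generator `σ_{i+1}` of `B₄`. -/
def braidGen (i : Fin 3) : Braid4 := PresentedGroup.of i

lemma laurent_T_mul_inv : (LaurentPolynomial.T 1 : ℤ[T;T⁻¹]) * LaurentPolynomial.T (-1) = 1 := by
  rw [← LaurentPolynomial.T_add]; simp

/-- The reduced Burau matrices of the generators `σ₁, σ₂, σ₃` of `B₄`. -/
def burauGen : Fin 3 → Matrix.GeneralLinearGroup (Fin 3) ℤ[T;T⁻¹] :=
  ![⟨!![-LaurentPolynomial.T 1, 1, 0;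
        0, 1, 0;
        0, 0, 1],
      !![-LaurentPolynomial.T (-1), LaurentPolynomial.T (-1), 0;
        0, 1, 0;
        0, 0, 1],
      by
        have h := laurent_T_mul_inv
        generalize (LaurentPolynomial.T 1 : ℤ[T;T⁻¹]) = u at *
        generalize (LaurentPolynomial.T (-1) : ℤ[T;T⁻¹]) = v at *
        ext1 i j
        fin_cases i <;> fin_cases j <;>
          simp [Matrix.mul_apply, Fin.sum_univ_three, h],
      by
        have h := laurent_T_mul_inv
        generalize (LaurentPolynomial.T 1 : ℤ[T;T⁻¹]) = u at *
        generalize (LaurentPolynomial.T (-1) : ℤ[T;T⁻¹]) = v at *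
        ext1 i j
        fin_cases i <;> fin_cases j <;>
          simp [Matrix.mul_apply, Fin.sum_univ_three, mul_comm v u, h]⟩,
    ⟨!![1, 0, 0;
        LaurentPolynomial.T 1, -LaurentPolynomial.T 1, 1;
        0, 0, 1],
      !![1, 0, 0;
        1, -LaurentPolynomial.T (-1), LaurentPolynomial.T (-1);
        0, 0, 1],
      by
        have h := laurent_T_mul_inv
        generalize (LaurentPolynomial.T 1 : ℤ[T;T⁻¹]) = u at *
        generalize (LaurentPolynomial.T (-1) : ℤ[T;T⁻¹]) = v at *
        ext1 i j
        fin_cases i <;> fin_cases j <;>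
          simp [Matrix.mul_apply, Fin.sum_univ_three, h],
      by
        have h := laurent_T_mul_inv
        generalize (LaurentPolynomial.T 1 : ℤ[T;T⁻¹]) = u at *
        generalize (LaurentPolynomial.T (-1) : ℤ[T;T⁻¹]) = v at *
        ext1 i j
        fin_cases i <;> fin_cases j <;>
          simp [Matrix.mul_apply, Fin.sum_univ_three, mul_comm v u, h]⟩,
    ⟨!![1, 0, 0;
        0, 1, 0;
        0, LaurentPolynomial.T 1, -LaurentPolynomial.T 1],
      !![1, 0, 0;
        0, 1, 0;
        0, 1, -LaurentPolynomial.T (-1)],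
      by
        have h := laurent_T_mul_inv
        generalize (LaurentPolynomial.T 1 : ℤ[T;T⁻¹]) = u at *
        generalize (LaurentPolynomial.T (-1) : ℤ[T;T⁻¹]) = v at *
        ext1 i j
        fin_cases i <;> fin_cases j <;>
          simp [Matrix.mul_apply, Fin.sum_univ_three, h],
      by
        have h := laurent_T_mul_inv
        generalize (LaurentPolynomial.T 1 : ℤ[T;T⁻¹]) = u at *
        generalize (LaurentPolynomial.T (-1) : ℤ[T;T⁻¹]) = v at *
        ext1 i j
        fin_cases i <;> fin_cases j <;>
          simp [Matrix.mul_apply, Fin.sum_univ_three, mul_comm v u, h]⟩]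

lemma burauGen_rels : ∀ r ∈ braidRels4, FreeGroup.lift burauGen r = 1 := by
  intro r hr
  simp only [braidRels4, Set.mem_insert_iff, Set.mem_singleton_iff] at hr
  rcases hr with rfl | rfl | rfl <;>
    simp only [map_mul, map_inv, FreeGroup.lift_apply_of, mul_inv_eq_one] <;>
    · apply Units.ext
      ext1 i j
      fin_cases i <;> fin_cases j <;>
        simp [burauGen, Matrix.mul_apply, Fin.sum_univ_three]

/-- The (reduced) Burau representation of `B₄`. -/
def burau4 : Braid4 →* Matrix.GeneralLinearGroup (Fin 3) ℤ[T;T⁻¹] :=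
  PresentedGroup.toGroup burauGen_rels

/-- The Burau representation of `B₄` reduced modulo `p`. -/
def burau4Mod (p : ℕ) : Braid4 →* Matrix.GeneralLinearGroup (Fin 3) (ZMod p)[T;T⁻¹] :=
  (Matrix.GeneralLinearGroup.map (laurentMod p)).comp burau4

end

/-! The proof is ping-pong on `K³`, where `K` is a valued field receiving `𝔽_p` and `t` goes to a
nonzero element with `v t < 1`. There `f` becomes `D = diag(t, 1, t⁻¹)` and `k` becomes `P D P⁻¹`,
with `P` the eigenvector matrix `eigenMatrix t`.

Write `A e` for `dominatedSet v t e` (outer coordinates at least `t²` apart) and `B d` for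
`balancedSet v t d` (outer coordinates exactly `t` apart). Three inclusions carry the argument: `D ^
N` sends `B d` into `A (t² d)` when `|N| ≥ 3`; `P` sends `A (t²)` into `B (t⁻¹)`; `P⁻¹` sends `A t`
into `B 1`. Put `X = A t` and `Y = P (A (t²))`. Nontrivial powers of `f ^ m` send `Y ⊆ B (t⁻¹)` into
`A t = X`, and those of `k ^ n` send `X` through `B 1` and `A (t²)` into `Y`. Since every `A` is
disjoint from every `B`, `X` and `Y` are disjoint.

For the Burau images, one explicit change of basis `Q` yields the same pair `D⁻¹`, `P D P⁻¹`. -/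

/-! ### Ping-pong for two elements -/

open Pointwise in
/-- Ping-pong for two group elements: if every nontrivial power of `g` maps `Y` into `X` and every
nontrivial power of `h` maps `X` into `Y`, then `g` and `h` are free generators. -/
theorem freeGroup_lift_pair_injective_of_ping_pong {G α : Type*} [Group G] [MulAction G α]
    (g h : G) (X Y : Set α) (hX : X.Nonempty) (hY : Y.Nonempty) (hXY : Disjoint X Y)
    (hg : ∀ a : ℤ, a ≠ 0 → ∀ y ∈ Y, g ^ a • y ∈ X)
    (hh : ∀ a : ℤ, a ≠ 0 → ∀ x ∈ X, h ^ a • x ∈ Y) :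
    Function.Injective (FreeGroup.lift ![g, h]) := by
  have hlift : FreeGroup.lift ![g, h] =
      (Monoid.CoprodI.lift fun i => FreeGroup.lift fun _ : Unit => ![g, h] i).comp
        (freeGroupEquivCoprodI (ι := Fin 2)).toMonoidHom := by
    ext i
    simp
  rw [hlift, MonoidHom.coe_comp]
  refine Function.Injective.comp ?_ freeGroupEquivCoprodI.injective
  refine Monoid.CoprodI.lift_injective_of_ping_pong
    (fun i => FreeGroup.lift fun _ : Unit => ![g, h] i) (Or.inr ⟨0, ?_⟩) ![X, Y] ?_ ?_ ?_
  -- With only two factors, ping-pong requires one of them to have at least three elements.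
  · have : Infinite (FreeGroup Unit) := FreeGroup.freeGroupUnitEquivInt.infinite_iff.mpr inferInstance
    exact (Cardinal.natCast_le_aleph0 (n := 3)).trans (Cardinal.aleph0_le_mk _)
  · intro i
    fin_cases i
    exacts [hX, hY]
  · intro i j hij
    fin_cases i <;> fin_cases j <;> first | exact absurd rfl hij | exact hXY | exact hXY.symm
  · intro i j hij
    refine FreeGroup.freeGroupUnitEquivInt.forall_congr_left.mpr ?_
    intro n hn
    have hn0 : n ≠ 0 := by
      rintro rfl
      exact hn (by simp [FreeGroup.freeGroupUnitEquivInt])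
    change FreeGroup.lift (fun _ => ![g, h] i) (FreeGroup.of () ^ n) • ![X, Y] j ⊆ ![X, Y] i
    simp only [map_zpow, FreeGroup.lift_apply_of]
    rintro _ ⟨y, hy, rfl⟩
    fin_cases i <;> fin_cases j
    exacts [absurd rfl hij, hg n hn0 y hy, hh n hn0 y hy, absurd rfl hij]

theorem nonempty_freeGroup_mulEquiv_closure_pair {G : Type*} [Group G] {g h : G}
    (H : Function.Injective (FreeGroup.lift ![g, h])) :
    Nonempty (FreeGroup (Fin 2) ≃* Subgroup.closure {g, h}) := by
  have hr : (FreeGroup.lift ![g, h]).range = Subgroup.closure {g, h} := by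
    rw [FreeGroup.range_lift_eq_closure]
    simp [Matrix.range_cons, Set.pair_comm]
  exact ⟨(MonoidHom.ofInjective H).trans (MulEquiv.subgroupCongr hr)⟩

/-! ### Valuation estimates for the ping-pong sets -/

section PingPongSets

variable {K Γ : Type*} [Field K] [LinearOrderedCommGroupWithZero Γ]

/-- The homomorphism `u ↦ diag(u, 1, u⁻¹)` into `GL₃(K)`. -/
def diagGL (K : Type*) [Field K] : Kˣ →* Matrix.GeneralLinearGroup (Fin 3) K where
  toFun u := ⟨Matrix.diagonal ![(u : K), 1, (u : K)⁻¹], Matrix.diagonal ![(u : K)⁻¹, 1, (u : K)],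
    by ext i j; fin_cases i <;> fin_cases j <;> simp,
    by ext i j; fin_cases i <;> fin_cases j <;> simp⟩
  map_one' := by ext i j; fin_cases i <;> fin_cases j <;> simp
  map_mul' u w := by ext i j; fin_cases i <;> fin_cases j <;> simp [mul_comm]

theorem diagGL_mulVec (u : Kˣ) (x y z : K) :
    (diagGL K u).val.mulVec ![x, y, z] = ![u * x, y, (u : K)⁻¹ * z] := by
  ext i
  fin_cases i <;> simp [diagGL, Matrix.mulVec_diagonal]

/-- A matrix whose columns are eigenvectors of `k` for the eigenvalues `t, 1, t⁻¹`. -/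
def eigenMatrix (t : K) : Matrix (Fin 3) (Fin 3) K :=
  !![t, 1, 1; -(t + t⁻¹), -(1 + t⁻¹), -(t + t⁻¹); 1, 1, t]

theorem det_eigenMatrix {t : K} (ht : t ≠ 0) : (eigenMatrix t).det = (t - 1) ^ 3 / t := by
  rw [eigenMatrix, Matrix.det_fin_three]
  simp
  field_simp
  ring

/-- Vectors whose first or last coordinate is dominated by the other one, and whose middle
coordinate is dominated up to the factor `e`. -/
def dominatedSet (v : Valuation K Γ) (t e : K) : Set (Fin 3 → K) :=
  {w | ∃ z x y : K, z ≠ 0 ∧ v x ≤ 1 ∧ v y ≤ 1 ∧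
    (w = ![z * (t ^ 2 * x), z * (e * y), z] ∨ w = ![z, z * (e * y), z * (t ^ 2 * x)])}

/-- Vectors whose outer coordinates differ by exactly one in valuation, and whose middle
coordinate is bounded up to the factor `d`. -/
def balancedSet (v : Valuation K Γ) (t d : K) : Set (Fin 3 → K) :=
  {w | ∃ z u u' c : K, z ≠ 0 ∧ v u = 1 ∧ v u' = 1 ∧ v c ≤ 1 ∧
    (w = ![z * u, z * (d * c), z * (t * u')] ∨ w = ![z * (t * u), z * (d * c), z * u'])}

variable {v : Valuation K Γ} {t : K}

theorem ne_zero_of_valuation_eq_one {u : K} (hu : v u = 1) : u ≠ 0 := by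
  rintro rfl
  simp at hu

/-- This is where exponent 3 enters. In the worst case the outer coordinate that becomes dominant
starts a factor `t` behind, so relative to it the middle one gains only `t ^ (3 - 1)` and the other
outer one `t ^ (2 * 3 - 1)`. -/
theorem diagGL_mulVec_mem_dominatedSet {t : Kˣ} (ht : v t < 1) {d e : K} (hde : (t : K) ^ 2 * d = e)
    {N : ℤ} (hN : 3 ≤ |N|) {w : Fin 3 → K} (hw : w ∈ balancedSet v t d) :
    (diagGL K (t ^ N)).val.mulVec w ∈ dominatedSet v t e := by
  have ht0 : (t : K) ≠ 0 := t.ne_zero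
  -- The integral factor `r` absorbs all powers of `t` beyond the third, leaving only the sign of
  -- `N` to distinguish.
  obtain ⟨r, hr0, hr, hN⟩ : ∃ r : K, r ≠ 0 ∧ v r ≤ 1 ∧
      (((t ^ N : Kˣ) : K) = r * t ^ 3 ∨ ((t ^ N : Kˣ) : K) = (r * t ^ 3)⁻¹) := by
    have hle : ∀ j : ℕ, v ((t : K) ^ j) ≤ 1 := fun j => by
      rw [map_pow]
      exact pow_le_one₀ zero_le ht.le
    obtain ⟨j, hj⟩ : ∃ j : ℕ, N.natAbs = j + 3 := ⟨N.natAbs - 3, by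
      have := Int.abs_eq_natAbs N
      omega⟩
    refine ⟨t ^ j, pow_ne_zero _ ht0, hle _, ?_⟩
    rw [← pow_add, ← hj, Units.val_zpow_eq_zpow_val]
    rcases Int.natAbs_eq N with h | h
    · left
      rw [h, zpow_natCast, Int.natAbs_natCast]
    · right
      rw [h, zpow_neg, zpow_natCast, Int.natAbs_neg, Int.natAbs_natCast]
  obtain ⟨z, u, u', c, hz, hu, hu', hc, hw⟩ := hw
  have hu0 := ne_zero_of_valuation_eq_one hu
  have hu'0 := ne_zero_of_valuation_eq_one hu'
  subst hde
  have b1 : v (r * c / u') ≤ 1 := by simpa [hu'] using mul_le_one' hr hc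
  have b2 : v (r * c / u) ≤ 1 := by simpa [hu] using mul_le_one' hr hc
  have b3 : ∀ k, v (r ^ 2 * t ^ k) ≤ 1 := fun k => by
    rw [map_mul, map_pow, map_pow]
    exact mul_le_one' (pow_le_one₀ zero_le hr) (pow_le_one₀ zero_le ht.le)
  have b4 : ∀ k, v (r ^ 2 * t ^ k * u / u') ≤ 1 := fun k => by
    simpa [hu, hu'] using b3 k
  have b5 : ∀ k, v (r ^ 2 * t ^ k * u' / u) ≤ 1 := fun k => by
    simpa [hu, hu'] using b3 k
  have b6 : v (t * (r * c / u)) ≤ 1 := by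
    rw [map_mul]; exact mul_le_one' ht.le b2
  have b7 : v (t * (r * c / u')) ≤ 1 := by
    rw [map_mul]; exact mul_le_one' ht.le b1
  rcases hw with rfl | rfl <;> rcases hN with hN | hN <;> rw [diagGL_mulVec, hN]
  · refine ⟨z * u' * t / (r * t ^ 3), r ^ 2 * t ^ 3 * u / u', r * c / u',
      ?_, b4 3, b1, Or.inl ?_⟩
    · simp [*]
    ext i; fin_cases i <;> simp <;> field_simp
  · refine ⟨z * u / (r * t ^ 3), r ^ 2 * t ^ 5 * u' / u, t * (r * c / u), ?_, b5 5, b6, Or.inr ?_⟩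
    · simp [*]
    ext i; fin_cases i <;> simp <;> field_simp
  · refine ⟨z * u' / (r * t ^ 3), r ^ 2 * t ^ 5 * u / u', t * (r * c / u'), ?_, b4 5, b7, Or.inl ?_⟩
    · simp [*]
    ext i; fin_cases i <;> simp <;> field_simp
  · refine ⟨z * u * t / (r * t ^ 3), r ^ 2 * t ^ 3 * u' / u, r * c / u, ?_, b5 3, b2, Or.inr ?_⟩
    · simp [*]
    ext i; fin_cases i <;> simp <;> field_simp

theorem valuation_one_add_mul (ht : v t < 1) {x : K} (hx : v x ≤ 1) : v (1 + t * x) = 1 :=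
  v.map_one_add_of_lt (by rw [map_mul]; exact mul_lt_one_of_lt_of_le ht hx)

/-- The dominant coordinate meets the entries `1` and `t` in the outer rows, which fixes the ratio
of the outer coordinates. The middle column has outer entries `1`, so the middle coordinate must be
as small as `t²` not to disturb the term `t`. The poles in the middle row cost the factor `t⁻¹`. -/
theorem eigenMatrix_mulVec_mem_balancedSet (ht0 : t ≠ 0) (ht : v t < 1) {w : Fin 3 → K}
    (hw : w ∈ dominatedSet v t (t ^ 2)) :
    (eigenMatrix t).mulVec w ∈ balancedSet v t t⁻¹ := by
  obtain ⟨z, x, y, hz, hx, hy, hw⟩ := hw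
  have h0 : t ∈ v.integer := ht.le
  have hx' : x ∈ v.integer := hx
  have hy' : y ∈ v.integer := hy
  have b1 : v (1 + t * (t * y + t ^ 2 * x)) = 1 := valuation_one_add_mul ht
    (add_mem (mul_mem h0 hy') (mul_mem (pow_mem h0 2) hx'))
  have b2 : v (1 + t * (y + x)) = 1 := valuation_one_add_mul ht (add_mem hy' hx')
  have b3 : v (-(t ^ 2 + 1) * (t ^ 2 * x) - (t + 1) * (t ^ 2 * y) - (t ^ 2 + 1)) ≤ 1 := by
    change _ ∈ v.integer
    have := one_mem v.integer
    have h2 := pow_mem h0 2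
    exact sub_mem (sub_mem (mul_mem (neg_mem (add_mem h2 this)) (mul_mem h2 hx'))
      (mul_mem (add_mem h0 this) (mul_mem h2 hy'))) (add_mem h2 this)
  rcases hw with rfl | rfl
  · refine ⟨z, _, _, _, hz, b1, b2, b3, Or.inl ?_⟩
    ext i
    fin_cases i <;> simp [eigenMatrix, Matrix.mulVec, dotProduct, Fin.sum_univ_three] <;>
      field_simp <;> ring
  · refine ⟨z, _, _, _, hz, b2, b1, b3, Or.inr ?_⟩
    ext i
    fin_cases i <;> simp [eigenMatrix, Matrix.mulVec, dotProduct, Fin.sum_univ_three] <;>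
      field_simp <;> ring

/-- The matrix `-(t - 1)² P⁻¹` has polynomial entries, with rows `(1, t, t)`, `(-(1 + t²), -(t +
t²), -(1 + t²))`, `(t, t, 1)`. Its middle column is divisible by `t`, so here a middle coordinate of
size `t` is small enough, and no pole appears. -/
theorem exists_mem_balancedSet_eigenMatrix_mulVec_eq (ht0 : t ≠ 0) (ht : v t < 1) {w : Fin 3 → K}
    (hw : w ∈ dominatedSet v t t) :
    ∃ w' ∈ balancedSet v t 1, (eigenMatrix t).mulVec w' = w := by
  obtain ⟨z, x, y, hz, hx, hy, hw⟩ := hw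
  have h0 : t ∈ v.integer := ht.le
  have hx' : x ∈ v.integer := hx
  have hy' : y ∈ v.integer := hy
  have ht1 : t - 1 ≠ 0 := by
    intro h
    rw [sub_eq_zero.mp h, map_one] at ht
    exact lt_irrefl _ ht
  have b1 : v (1 + t * (x + y)) = 1 := valuation_one_add_mul ht (add_mem hx' hy')
  have b2 : v (1 + t * (t * y + t ^ 2 * x)) = 1 := valuation_one_add_mul ht
    (add_mem (mul_mem h0 hy') (mul_mem (pow_mem h0 2) hx'))
  have b3 : v (-((1 + t ^ 2) * (t ^ 2 * x)) - (t + t ^ 2) * (t * y) - (1 + t ^ 2)) ≤ 1 := by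
    change _ ∈ v.integer
    have := one_mem v.integer
    have h2 := pow_mem h0 2
    exact sub_mem (sub_mem (neg_mem (mul_mem (add_mem this h2) (mul_mem h2 hx')))
      (mul_mem (add_mem h0 h2) (mul_mem h0 hy'))) (add_mem this h2)
  have hz' : -z / (t - 1) ^ 2 ≠ 0 := by
    simp [hz, ht1]
  rcases hw with rfl | rfl
  · refine ⟨_, ⟨-z / (t - 1) ^ 2, _, _, _, hz', b1, b2, b3, Or.inr rfl⟩, ?_⟩
    ext i
    fin_cases i <;> simp [eigenMatrix, Matrix.mulVec, dotProduct, Fin.sum_univ_three] <;>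
      field_simp <;> ring
  · refine ⟨_, ⟨-z / (t - 1) ^ 2, _, _, _, hz', b2, b1, b3, Or.inl rfl⟩, ?_⟩
    ext i
    fin_cases i <;> simp [eigenMatrix, Matrix.mulVec, dotProduct, Fin.sum_univ_three] <;>
      field_simp <;> ring

/-- Only the outer coordinates matter: their valuations differ by at least `v t ^ 2` in one set and
by exactly `v t` in the other. -/
theorem disjoint_dominatedSet_balancedSet (ht0 : t ≠ 0) (ht : v t < 1) (d e : K) :
    Disjoint (dominatedSet v t e) (balancedSet v t d) := by
  have key : ∀ a b : Γ, b ≠ 0 → a ≤ v t ^ 2 * b → b = v t * a ∨ a = v t * b → False := by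
    intro a b hb hab h
    have hq : 0 < v t := by simpa [zero_lt_iff] using ht0
    have hb' : 0 < b := zero_lt_iff.mpr hb
    have h2 : v t ^ 2 * b < v t * b :=
      mul_lt_mul_of_pos_right (by simpa [pow_two] using mul_lt_mul_of_pos_left ht hq) hb'
    have h1 : v t * b < b := by simpa using mul_lt_mul_of_pos_right ht hb'
    rcases h with h | h
    · have : b ≤ a := h.le.trans (mul_le_of_le_one_left' ht.le)
      exact absurd (this.trans_lt (hab.trans_lt (h2.trans h1))) (lt_irrefl _)
    · exact absurd (hab.trans_lt h2) (h ▸ lt_irrefl _)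
  rw [Set.disjoint_left]
  rintro w ⟨z, x, y, hz, hx, hy, hw⟩ ⟨z', u, u', c, hz', hu, hu', hc, hw'⟩
  have h1 : v (w 2) = v t * v (w 0) ∨ v (w 0) = v t * v (w 2) := by
    rcases hw' with rfl | rfl
    · left; simp [hu, hu', mul_comm]
    · right; simp [hu, hu', mul_comm]
  rcases hw with rfl | rfl
  · refine key _ _ ?_ ?_ h1
    · simpa using hz
    · simpa [mul_comm (v z)] using mul_le_mul_left (mul_le_of_le_one_right' hx) (v z)
  · refine key _ _ ?_ ?_ h1.symm
    · simpa using hz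
    · simpa [mul_comm (v z)] using mul_le_mul_left (mul_le_of_le_one_right' hx) (v z)

end PingPongSets

/-! ### Freeness of conjugated diagonal pairs -/

/-- Freeness is detected in any action, so `Φ` need not be injective. Acting through `Q⁻¹ Φ Q` makes
`g` diagonal and `h` diagonal in the basis `P`. Signed exponents allow for `α`, which is conjugate
to `D⁻¹`. -/
theorem lift_pair_injective_of_conj_diagGL {G K Γ : Type*} [Group G] [Field K]
    [LinearOrderedCommGroupWithZero Γ] {v : Valuation K Γ} {t : Kˣ} (ht : v t < 1)
    (Φ : G →* Matrix.GeneralLinearGroup (Fin 3) K) {g h : G}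
    {P Q : Matrix.GeneralLinearGroup (Fin 3) K} (hP : P.val = eigenMatrix (t : K)) {M N : ℤ}
    (hM : 3 ≤ |M|) (hN : 3 ≤ |N|) (hg : Φ g = Q * diagGL K (t ^ M) * Q⁻¹)
    (hh : Φ h = (Q * P) * diagGL K (t ^ N) * (Q * P)⁻¹) :
    Function.Injective (FreeGroup.lift ![g, h]) := by
  have ht0 : (t : K) ≠ 0 := t.ne_zero
  let Ψ : G →* (Module.End K (Fin 3 → K))ˣ :=
    Matrix.GeneralLinearGroup.toLin.toMonoidHom.comp ((MulAut.conj Q⁻¹).toMonoidHom.comp Φ)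
  let : MulAction G (Fin 3 → K) := MulAction.compHom _ Ψ
  have hΨ : ∀ (x : G) (w : Fin 3 → K), x • w = (Q⁻¹ * Φ x * Q).val.mulVec w := fun x w => by
    change (Matrix.GeneralLinearGroup.toLin (Q⁻¹ * Φ x * Q⁻¹⁻¹)).val w = _
    rw [inv_inv, Matrix.GeneralLinearGroup.coe_toLin, Matrix.mulVecLin_apply]
  have hg' : ∀ (a : ℤ) w, g ^ a • w = (diagGL K (t ^ (M * a))).val.mulVec w := fun a w => by
    rw [hΨ, map_zpow, hg, conj_zpow, ← map_zpow, ← zpow_mul]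
    congr 2
    group
  have hh' : ∀ (a : ℤ) w, h ^ a • P.val.mulVec w =
      P.val.mulVec ((diagGL K (t ^ (N * a))).val.mulVec w) := fun a w => by
    rw [hΨ, map_zpow, hh, conj_zpow, ← map_zpow, ← zpow_mul, Matrix.mulVec_mulVec,
      Matrix.mulVec_mulVec, ← Units.val_mul, ← Units.val_mul]
    congr 2
    group
  have habs : ∀ {k a : ℤ}, 3 ≤ |k| → a ≠ 0 → 3 ≤ |k * a| := fun {k a} hk ha => by
    rw [abs_mul]
    exact hk.trans (le_mul_of_one_le_right (abs_nonneg _) (Int.one_le_abs ha))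
  have hne : ∀ e : K, (dominatedSet v (t : K) e).Nonempty := fun e =>
    ⟨_, 1, 0, 0, one_ne_zero, by simp, by simp, Or.inl rfl⟩
  refine freeGroup_lift_pair_injective_of_ping_pong g h (dominatedSet v (t : K) t)
    (P.val.mulVec '' dominatedSet v (t : K) (t ^ 2)) (hne _) ((hne _).image _) ?_ ?_ ?_
  · refine (disjoint_dominatedSet_balancedSet ht0 ht (t : K)⁻¹ t).mono_right ?_
    rintro _ ⟨w, hw, rfl⟩
    rw [hP]
    exact eigenMatrix_mulVec_mem_balancedSet ht0 ht hw
  · rintro a ha _ ⟨w, hw, rfl⟩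
    rw [hg', hP]
    exact diagGL_mulVec_mem_dominatedSet ht (by field_simp) (habs hM ha)
      (eigenMatrix_mulVec_mem_balancedSet ht0 ht hw)
  · intro a ha w hw
    obtain ⟨w', hw', rfl⟩ := exists_mem_balancedSet_eigenMatrix_mulVec_eq ht0 ht hw
    rw [← hP, hh']
    exact ⟨_, diagGL_mulVec_mem_dominatedSet ht (mul_one _) (habs hN ha) hw', rfl⟩

/-! ### Specialization of the matrices and of the Burau representation -/

theorem eval₂_laurentMod_T {p : ℕ} {K : Type*} [Field K] (f : ZMod p →+* K) (x : Kˣ) (n : ℤ) :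
    LaurentPolynomial.eval₂ f x (laurentMod p (LaurentPolynomial.T n)) = (x : K) ^ n := by
  have : laurentMod p (LaurentPolynomial.T n) = LaurentPolynomial.T n := by
    ext i
    by_cases h : n = i <;> simp [laurentMod, LaurentPolynomial.T_apply, h]
  rw [this, LaurentPolynomial.eval₂_T, Units.val_zpow_eq_zpow_val]

theorem exists_eigenMatrix_GL {K : Type*} [Field K] (t : Kˣ) (ht : (t : K) ≠ 1) :
    ∃ P : Matrix.GeneralLinearGroup (Fin 3) K, P.val = eigenMatrix (t : K) :=
  ⟨Matrix.GeneralLinearGroup.mkOfDetNeZero (eigenMatrix (t : K)) (by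
    rw [det_eigenMatrix t.ne_zero]
    exact div_ne_zero (pow_ne_zero _ (sub_ne_zero.mpr ht)) t.ne_zero), rfl⟩

theorem freeGroup_lift_burauF_burauK_injective {p : ℕ} {K Γ : Type*} [Field K]
    [LinearOrderedCommGroupWithZero Γ] {v : Valuation K Γ} {t : Kˣ} (ht : v t < 1)
    (f : ZMod p →+* K) {m n : ℕ} (hm : 3 ≤ m) (hn : 3 ≤ n) :
    Function.Injective (FreeGroup.lift
      ![Matrix.SpecialLinearGroup.map (laurentMod p) burauF ^ m,
        Matrix.SpecialLinearGroup.map (laurentMod p) burauK ^ n]) := by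
  have ht0 : (t : K) ≠ 0 := t.ne_zero
  obtain ⟨P, hP⟩ := exists_eigenMatrix_GL t (fun h => by simp [h] at ht)
  let Φ : Matrix.SpecialLinearGroup (Fin 3) (ZMod p)[T;T⁻¹] →* Matrix.GeneralLinearGroup (Fin 3) K :=
    Matrix.SpecialLinearGroup.toGL.comp
      (Matrix.SpecialLinearGroup.map (LaurentPolynomial.eval₂ f t))
  have hΦ : ∀ g, (Φ (Matrix.SpecialLinearGroup.map (laurentMod p) g)).val =
      g.val.map fun x => LaurentPolynomial.eval₂ f t (laurentMod p x) := fun g => rfl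
  have hF : Φ (Matrix.SpecialLinearGroup.map (laurentMod p) burauF) = diagGL K t := by
    apply Units.ext
    rw [hΦ]
    ext i j
    fin_cases i <;> fin_cases j <;> simp [burauF, diagGL, eval₂_laurentMod_T]
  have hK : Φ (Matrix.SpecialLinearGroup.map (laurentMod p) burauK) = P * diagGL K t * P⁻¹ := by
    rw [eq_mul_inv_iff_mul_eq]
    apply Units.ext
    rw [Units.val_mul, Units.val_mul, hΦ, hP]
    ext i j
    fin_cases i <;> fin_cases j <;>
      simp [burauK, diagGL, eval₂_laurentMod_T, Matrix.mul_apply, Fin.sum_univ_three,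
        eigenMatrix, zpow_neg, -zpow_natCast] <;> field_simp <;> ring
  refine lift_pair_injective_of_conj_diagGL ht Φ (Q := 1) hP (M := m) (N := n) ?_ ?_ ?_ ?_
  · simpa using hm
  · simpa using hn
  · simp [hF]
  · simp [hK, conj_pow]

theorem freeGroup_lift_burau4Mod_injective {p : ℕ} {K Γ : Type*} [Field K]
    [LinearOrderedCommGroupWithZero Γ] {v : Valuation K Γ} {t : Kˣ} (ht : v t < 1)
    (f : ZMod p →+* K) {m n : ℕ} (hm : 3 ≤ m) (hn : 3 ≤ n) :
    Function.Injective (FreeGroup.lift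
      ![burau4Mod p (braidGen 0 * (braidGen 2)⁻¹) ^ m,
        burau4Mod p (braidGen 1 * (braidGen 0 * (braidGen 2)⁻¹) * (braidGen 1)⁻¹) ^ n]) := by
  have ht0 : (t : K) ≠ 0 := t.ne_zero
  have ht1 : 1 - (t : K) ≠ 0 := fun h => by simp [← sub_eq_zero.mp h] at ht
  have ht2 : (t : K) ^ 2 + 1 ≠ 0 := fun h => by
    have := valuation_one_add_mul ht ht.le
    rw [show 1 + (t : K) * t = t ^ 2 + 1 by ring, h, map_zero] at this
    exact zero_ne_one this
  obtain ⟨P, hP⟩ := exists_eigenMatrix_GL t (fun h => by simp [h] at ht)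
  -- The columns are eigenvectors of the image of `α⁻¹` for `t, 1, t⁻¹`, scaled so that `hσ` below
  -- holds with the same `P` as for `k`.
  let q : Matrix (Fin 3) (Fin 3) K :=
    !![0, -(t / (t ^ 2 + 1)), -(t : K)⁻¹;
      0, -(t / (t ^ 2 + 1)) * (1 - t), 0;
      1, (t / (t ^ 2 + 1)) * t, 0]
  obtain ⟨Q, hQ⟩ : ∃ Q : Matrix.GeneralLinearGroup (Fin 3) K, Q.val = q :=
    ⟨Matrix.GeneralLinearGroup.mkOfDetNeZero q (by
      rw [Matrix.det_fin_three]
      simp [q, ht0, ht1, ht2]), rfl⟩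
  let Φ : Matrix.GeneralLinearGroup (Fin 3) (ZMod p)[T;T⁻¹] →* Matrix.GeneralLinearGroup (Fin 3) K :=
    Matrix.GeneralLinearGroup.map (LaurentPolynomial.eval₂ f (-t))
  have hΦ : ∀ i, Φ (burau4Mod p (braidGen i)) = Matrix.GeneralLinearGroup.map
      ((LaurentPolynomial.eval₂ f (-t)).comp (laurentMod p)) (burauGen i) := fun i => by
    rw [Matrix.GeneralLinearGroup.map_comp]
    simp [Φ, burau4Mod, burau4, braidGen]
  have h0 : (Φ (burau4Mod p (braidGen 0))).val = !![(t : K), 1, 0; 0, 1, 0; 0, 0, 1] := by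
    rw [hΦ]
    ext i j
    fin_cases i <;> fin_cases j <;> simp [burauGen, eval₂_laurentMod_T]
  have h1 : (Φ (burau4Mod p (braidGen 1))).val = !![1, 0, 0; -(t : K), t, 1; 0, 0, 1] := by
    rw [hΦ]
    ext i j
    fin_cases i <;> fin_cases j <;> simp [burauGen, eval₂_laurentMod_T]
  have h2 : (Φ (burau4Mod p (braidGen 2))).val = !![1, 0, 0; 0, 1, 0; 0, -(t : K), t] := by
    rw [hΦ]
    ext i j
    fin_cases i <;> fin_cases j <;> simp [burauGen, eval₂_laurentMod_T]
  have h2' : (Φ (burau4Mod p (braidGen 2)))⁻¹.val = !![1, 0, 0; 0, 1, 0; 0, 1, (t : K)⁻¹] := by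
    refine (Units.inv_eq_of_mul_eq_one_right ?_)
    rw [h2]
    ext i j
    fin_cases i <;> fin_cases j <;> simp [Matrix.mul_apply, Fin.sum_univ_three]
  have hα : Φ (burau4Mod p (braidGen 0 * (braidGen 2)⁻¹)) = Q * (diagGL K t)⁻¹ * Q⁻¹ := by
    rw [eq_mul_inv_iff_mul_eq, ← map_inv, map_mul, map_inv, map_mul, map_inv]
    apply Units.ext
    simp only [Units.val_mul, h0, h2', hQ]
    ext i j
    fin_cases i <;> fin_cases j <;>
      simp [q, diagGL, Matrix.mul_apply, Fin.sum_univ_three] <;> field_simp <;> ring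
  -- `W` swaps the eigenlines of `t` and `t⁻¹`, so it conjugates `D⁻¹` to `D`. Since `σ₂ Q = Q P W`,
  -- the conjugate `β = σ₂ α σ₂⁻¹` becomes `(Q P) D (Q P)⁻¹`.
  let w : Matrix (Fin 3) (Fin 3) K :=
    !![0, 0, (1 - (t : K))⁻¹; 0, t ^ 2 * (1 - (t : K))⁻¹, 0; (1 - (t : K))⁻¹, 0, 0]
  obtain ⟨W, hW⟩ : ∃ W : Matrix.GeneralLinearGroup (Fin 3) K, W.val = w :=
    ⟨Matrix.GeneralLinearGroup.mkOfDetNeZero w (by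
      rw [Matrix.det_fin_three]
      simp [w, ht0, ht1]), rfl⟩
  have hσ : Φ (burau4Mod p (braidGen 1)) * Q = Q * P * W := by
    apply Units.ext
    simp only [Units.val_mul, h1, hQ, hP, hW]
    ext i j
    fin_cases i <;> fin_cases j <;>
      simp [q, w, eigenMatrix, Matrix.mul_apply, Fin.sum_univ_three, ht1] <;>
      field_simp <;> ring
  have hWD : W * (diagGL K t)⁻¹ = diagGL K t * W := by
    rw [← map_inv]
    apply Units.ext
    simp only [Units.val_mul, hW]
    ext i j
    fin_cases i <;> fin_cases j <;>
      simp [w, diagGL, Matrix.mul_apply, Fin.sum_univ_three] <;> ring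
  have hβ : Φ (burau4Mod p (braidGen 1 * (braidGen 0 * (braidGen 2)⁻¹) * (braidGen 1)⁻¹)) =
      (Q * P) * diagGL K t * (Q * P)⁻¹ := by
    rw [map_mul, map_mul, map_mul, map_mul, map_inv, map_inv, hα,
      show (diagGL K t)⁻¹ = W⁻¹ * diagGL K t * W by rw [mul_assoc, ← hWD]; group,
      eq_mul_inv_of_mul_eq hσ]
    group
  refine lift_pair_injective_of_conj_diagGL ht Φ (Q := Q) hP (M := -m) (N := n) ?_ ?_ ?_ ?_
  · simpa using hm
  · simpa using hn
  · rw [map_pow, hα, conj_pow, map_zpow, zpow_neg, zpow_natCast, inv_pow]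
  · rw [map_pow, hβ, conj_pow, map_zpow, zpow_natCast]

theorem mainTheorem2 (p : ℕ) [Fact p.Prime] (m n : ℕ) (hm : 3 ≤ m) (hn : 3 ≤ n) :
    Nonempty (FreeGroup (Fin 2) ≃*
      Subgroup.closure
        {Matrix.SpecialLinearGroup.map (laurentMod p) burauF ^ m,
          Matrix.SpecialLinearGroup.map (laurentMod p) burauK ^ n}) ∧
    Nonempty (FreeGroup (Fin 2) ≃*
      Subgroup.closure
        {burau4Mod p (braidGen 0 * (braidGen 2)⁻¹) ^ m,
          burau4Mod p (braidGen 1 * (braidGen 0 * (braidGen 2)⁻¹) * (braidGen 1)⁻¹) ^ n}) := by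
  classical
  -- At the infinite place it is `X⁻¹`, not `X`, that has valuation below one.
  let t : (RatFunc (ZMod p))ˣ := (Units.mk0 RatFunc.X RatFunc.X_ne_zero)⁻¹
  have ht : RatFunc.inftyValuation (ZMod p) t < 1 := by
    have : (t : RatFunc (ZMod p)) = 1 / RatFunc.X := by simp [t]
    rw [this, RatFunc.inftyValuation.X_inv, ← WithZero.exp_zero, WithZero.exp_lt_exp]
    norm_num
  exact ⟨nonempty_freeGroup_mulEquiv_closure_pair
      (freeGroup_lift_burauF_burauK_injective ht RatFunc.C hm hn),
    nonempty_freeGroup_mulEquiv_closure_pair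
      (freeGroup_lift_burau4Mod_injective ht RatFunc.C hm hn)⟩
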